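/- Write $\mathbb{N}=\{1,2,3,\dots\}$ and $\mathbb{T}=\mathbb{R}/\mathbb{Z}$, and let $\|\cdot\|$ denote the Euclidean distance to zero on $\mathbb{T}^d$, $d\geq 1$. A Bohr neighbourhood of zero is a set of the form $\{n\in\mathbb{Z} : \|n\alpha\|<\delta\}$ with $d\in\mathbb{N}$, $\alpha\in\mathbb{T}^d$ and $\delta>0$. A sequence $g:\mathbb{Z}\to\mathbb{T}$ is Bohr almost periodic if for every $\varepsilon>0$ the set $\{m\in\mathbb{Z} : \sup_{n\in\mathbb{Z}}\|g(n+m)-g(n)\|<\varepsilon\}$ contains a Bohr neighbourhood of zero. A set $A\subseteq\mathbb{N}$ is syndetic if there is a finite set $F\subseteq\mathbb{N}$ with $A-F\supseteq\mathbb{N}$, where $A-B=\{a-b : a\in A,\ b\in B\}\subseteq\mathbb{Z}$. For $f:\mathbb{Z}\to\mathbb{T}$ let $\Delta_1 f(n)=f(n+1)-f(n)$, and let $\Delta_1^k$ be the $k$-th iterate of $\Delta_1$ ($\Delta_1^0 f=f$). Theorem. Let $f:\mathbb{Z}\to\mathbb{T}$ and let $k\geq 0$ be an integer such that $\Delta_1^k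 f$ is Bohr almost periodic. Then for every $\varepsilon>0$ the set \[A=\{n\in\mathbb{N} : \|f(n)-f(0)\|<\varepsilon\}\] is syndetic, and $A-A$ contains a Bohr neighbourhood of zero. In particular, for every $\varepsilon>0$ the set \[\Big\{m\in\mathbb{Z} : \inf_{n\in\mathbb{Z}}\|f(n+m)-f(n)\|<\varepsilon\Big\}\] contains a Bohr neighbourhood of zero. -/

import Mathlib

open scoped Pointwise

/-- The Bohr neighbourhoods of zero in `ℤ`: the sets `{n ∈ ℤ : ‖n α‖ < δ}` with `d ≥ 1`,
`α ∈ 𝕋^d`, `δ > 0`, where `‖·‖` is the Euclidean distance to zero on `𝕋^d = (ℝ/ℤ)^d`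
(the norm of a point of `UnitAddCircle` is its distance to zero in `ℝ/ℤ`). -/
def IsBohrNhdZero (U : Set ℤ) : Prop :=
  ∃ (d : ℕ) (α : Fin d → UnitAddCircle) (δ : ℝ), 0 < d ∧ 0 < δ ∧
    U = {n : ℤ | Real.sqrt (∑ i, ‖n • α i‖ ^ 2) < δ}

/-- A set of integers contains a Bohr neighbourhood of zero. -/
def ContainsBohrNhdZero (S : Set ℤ) : Prop :=
  ∃ U : Set ℤ, IsBohrNhdZero U ∧ U ⊆ S

/-- Bohr almost periodicity on `ℤ` of a sequence `g : ℤ → 𝕋`. -/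
def IsBohrAlmostPeriodic (g : ℤ → UnitAddCircle) : Prop :=
  ∀ ε : ℝ, 0 < ε → ContainsBohrNhdZero {m : ℤ | ⨆ n : ℤ, ‖g (n + m) - g n‖ < ε}

/-- A set `A` of positive integers is syndetic: there is a finite set `F` of positive integers
such that `A - F` contains every positive integer. -/
def IsSyndeticInPosInts (A : Set ℤ) : Prop :=
  A ⊆ Set.Ioi 0 ∧ ∃ F : Set ℤ, F.Finite ∧ F ⊆ Set.Ioi 0 ∧ Set.Ioi 0 ⊆ A - F

/-- The set of positive integers `n` for which `f n` is within `ε` of `f 0`. -/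
def posReturnTimes (f : ℤ → UnitAddCircle) (ε : ℝ) : Set ℤ :=
  {n : ℤ | 0 < n ∧ ‖f n - f 0‖ < ε}

open Set Filter Topology

/-! ### Bohr neighbourhoods and Bohr almost periodic sequences -/

/-! Induction on the order of differencing. Order 0 is read off the rotation of the Bohr
compactification of ℤ. For the step let y = Δ₁^k f, with Δ₁ y almost periodic. If p y is almost
periodic for some p > 0, so is y (`IsBohrAlmostPeriodic.of_nsmul`), and the order drops.

Otherwise Δ₁ y extends to a continuous φ on the compactification, and f is the last coordinate along
an orbit in a tower of k + 1 circle extensions of the rotation: the first has cocycle φ, each later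
one the preceding fibre coordinate. The first is minimal, since otherwise some p φ is a continuous
coboundary (`IsForwardMinimal.skew_or_coboundary`) and p y is almost periodic. The later ones are
then minimal because no nonzero multiple of a fibre coordinate is a coboundary
(`not_coboundary_snd`). Minimality gives bounded return times, hence syndeticity, and puts m in A -
A once the top cocycle has, at some base point, an m-step sum of norm below ε.

For k ≥ 1 the base is itself a circle extension, and moving along its fibre makes that sum vanish
for every m > 0. For k = 0 one needs `IsBohrAlmostPeriodic.exists_return`. If it fails at an almost
period m of Δ₁ f, then n ↦ f(n+m) - f(n) varies slowly and avoids 0, so it has a bounded slow real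
lift. Means of such lifts are, modulo 1, a character of m (`exists_character_of_tameLift`). Where
that character is small, the lift stays uniformly on one side of its own mean, which is absurd. -/

theorem containsBohrNhdZero_iff {S : Set ℤ} :
    ContainsBohrNhdZero S ↔ ∃ (F : Finset UnitAddCircle) (δ : ℝ), 0 < δ ∧
      ∀ n : ℤ, (∀ θ ∈ F, ‖n • θ‖ < δ) → n ∈ S := by
  classical
  constructor
  · rintro ⟨U, ⟨d, α, δ, hd, hδ, rfl⟩, hS⟩
    have hd' : (1 : ℝ) ≤ d := by exact_mod_cast hd
    refine ⟨Finset.univ.image α, δ / d, by positivity, fun n hn => hS ?_⟩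
    have h1 : ∀ i, ‖n • α i‖ < δ / d := fun i => hn _ (by simp)
    rw [mem_ofPred_eq, Real.sqrt_lt' hδ]
    have : Nonempty (Fin d) := ⟨⟨0, hd⟩⟩
    calc ∑ i, ‖n • α i‖ ^ 2 < ∑ _i : Fin d, (δ / d) ^ 2 :=
          Finset.sum_lt_sum_of_nonempty Finset.univ_nonempty fun i _ =>
            pow_lt_pow_left₀ (h1 i) (norm_nonneg _) two_ne_zero
      _ = δ ^ 2 / d := by
          rw [Finset.sum_const, Finset.card_univ, Fintype.card_fin, nsmul_eq_mul]
          field_simp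
      _ ≤ δ ^ 2 := div_le_self (by positivity) hd'
  · rintro ⟨F, δ, hδ, hS⟩
    -- The extra zero coordinate keeps the dimension positive when `F` is empty.
    let α : Fin (F.card + 1) → UnitAddCircle := fun i =>
      if h : (i : ℕ) < F.card then (F.equivFin.symm ⟨i, h⟩ : UnitAddCircle) else 0
    refine ⟨_, ⟨F.card + 1, α, δ, Nat.succ_pos _, hδ, rfl⟩, fun n hn => hS n fun θ hθ => ?_⟩
    obtain ⟨i, hi⟩ : ∃ i, α i = θ := by
      refine ⟨⟨F.equivFin ⟨θ, hθ⟩, (F.equivFin ⟨θ, hθ⟩).2.trans (Nat.lt_succ_self _)⟩, ?_⟩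
      simp [α]
    refine lt_of_le_of_lt ?_ hn
    refine Real.le_sqrt_of_sq_le ?_
    rw [← hi]
    exact Finset.single_le_sum (f := fun i => ‖n • α i‖ ^ 2) (fun j _ => by positivity)
      (Finset.mem_univ i)

theorem ContainsBohrNhdZero.mono {S S' : Set ℤ} (h : ContainsBohrNhdZero S) (hS : S ⊆ S') :
    ContainsBohrNhdZero S' :=
  let ⟨U, hU, hUS⟩ := h
  ⟨U, hU, hUS.trans hS⟩

theorem ContainsBohrNhdZero.inter {S S' : Set ℤ} (h : ContainsBohrNhdZero S)
    (h' : ContainsBohrNhdZero S') : ContainsBohrNhdZero (S ∩ S') := by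
  classical
  rw [containsBohrNhdZero_iff] at *
  obtain ⟨F, δ, hδ, hF⟩ := h
  obtain ⟨F', δ', hδ', hF'⟩ := h'
  refine ⟨F ∪ F', min δ δ', lt_min hδ hδ', fun n hn => ⟨hF n fun θ hθ => ?_, hF' n fun θ hθ => ?_⟩⟩
  · exact (hn θ (Finset.mem_union_left _ hθ)).trans_le (min_le_left _ _)
  · exact (hn θ (Finset.mem_union_right _ hθ)).trans_le (min_le_right _ _)

theorem containsBohrNhdZero_character (θ : UnitAddCircle) {ε : ℝ} (hε : 0 < ε) :
    ContainsBohrNhdZero {n : ℤ | ‖n • θ‖ < ε} :=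
  containsBohrNhdZero_iff.2 ⟨{θ}, ε, hε, fun n hn => hn θ (by simp)⟩

theorem ContainsBohrNhdZero.inter_neg {S : Set ℤ} (h : ContainsBohrNhdZero S) :
    ContainsBohrNhdZero (S ∩ -S) := by
  refine h.inter ?_
  rw [containsBohrNhdZero_iff] at *
  obtain ⟨F, δ, hδ, hF⟩ := h
  exact ⟨F, δ, hδ, fun n hn => hF (-n) fun θ hθ => by simpa using hn θ hθ⟩

theorem UnitAddCircle.norm_le_half (x : UnitAddCircle) : ‖x‖ ≤ 1 / 2 := by
  simpa using AddCircle.norm_le_half_period (p := (1 : ℝ)) (x := x) one_ne_zero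

theorem UnitAddCircle.exists_zsmul_eq {p : ℤ} (hp : p ≠ 0) (θ : UnitAddCircle) :
    ∃ η : UnitAddCircle, p • η = θ := by
  obtain ⟨x, rfl⟩ := QuotientAddGroup.mk_surjective θ
  refine ⟨((x / p : ℝ) : UnitAddCircle), ?_⟩
  rw [← AddCircle.coe_zsmul, zsmul_eq_mul, mul_div_cancel₀ _ (by exact_mod_cast hp)]

/-- The multiples of a positive integer by elements of a Bohr neighbourhood of zero contain a
Bohr neighbourhood of zero. -/
theorem ContainsBohrNhdZero.mul_left {S : Set ℤ} (h : ContainsBohrNhdZero S) {p : ℕ} (hp : 0 < p) :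
    ContainsBohrNhdZero {n : ℤ | ∃ m ∈ S, n = p * m} := by
  classical
  rw [containsBohrNhdZero_iff] at *
  obtain ⟨F, δ, hδ, hF⟩ := h
  have hp0 : (p : ℤ) ≠ 0 := by exact_mod_cast hp.ne'
  choose η hη using UnitAddCircle.exists_zsmul_eq hp0
  have hpR : (0 : ℝ) < p := by exact_mod_cast hp
  -- The character 1/p forces p ∣ n; the p-th parts `η θ` evaluated at p m give back θ at m.
  refine ⟨insert ((1 / p : ℝ) : UnitAddCircle) (F.image η), min δ (1 / p),
    lt_min hδ (by positivity), fun n hn => ?_⟩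
  have hdvd : (p : ℤ) ∣ n := by
    have h1 := (hn _ (Finset.mem_insert_self _ _)).trans_le (min_le_right _ _)
    rw [← AddCircle.coe_zsmul, UnitAddCircle.norm_eq, zsmul_eq_mul] at h1
    set r := round ((n : ℝ) * (1 / p)) with hr
    have h2 : |(n : ℝ) - r * p| < 1 := by
      have : (n : ℝ) - r * p = (n * (1 / p) - r) * p := by field_simp
      rw [this, abs_mul, abs_of_pos hpR]
      calc _ < 1 / (p : ℝ) * p := by gcongr
        _ = 1 := by field_simp
    have h3 : |n - r * p| < 1 := by exact_mod_cast h2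
    exact ⟨r, by rw [Int.abs_lt_one_iff] at h3; linarith⟩
  obtain ⟨m, rfl⟩ := hdvd
  refine ⟨m, hF m fun θ hθ => ?_, rfl⟩
  have := (hn (η θ) (by simp; exact Or.inr ⟨θ, hθ, rfl⟩)).trans_le (min_le_left _ _)
  rwa [mul_comm, mul_smul, hη] at this

theorem bddAbove_range_norm (g : ℤ → UnitAddCircle) : BddAbove (range fun n => ‖g n‖) :=
  ⟨1 / 2, by rintro _ ⟨n, rfl⟩; exact UnitAddCircle.norm_le_half _⟩

theorem isBohrAlmostPeriodic_iff {g : ℤ → UnitAddCircle} :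
    IsBohrAlmostPeriodic g ↔
      ∀ ε : ℝ, 0 < ε → ContainsBohrNhdZero {m : ℤ | ∀ n, ‖g (n + m) - g n‖ < ε} := by
  constructor
  · refine fun h ε hε => (h ε hε).mono fun m hm n => ?_
    exact (le_ciSup (bddAbove_range_norm fun n => g (n + m) - g n) n).trans_lt hm
  · refine fun h ε hε => (h (ε / 2) (by positivity)).mono fun m hm => ?_
    exact (ciSup_le fun n => (hm n).le).trans_lt (by linarith)

theorem UnitAddCircle.eq_zero_of_nsmul_eq_zero {p : ℕ} (hp : 0 < p) {x : UnitAddCircle}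
    (hx : p • x = 0) (hlt : ‖x‖ < 1 / p) : x = 0 := by
  by_contra hne
  have hfin : IsOfFinAddOrder x := isOfFinAddOrder_iff_nsmul_eq_zero.2 ⟨p, hp, hx⟩
  have h1 := AddCircle.le_add_order_smul_norm_of_isOfFinAddOrder hfin hne
  have h2 : addOrderOf x ≤ p := addOrderOf_le_of_nsmul_eq_zero hp hx
  rw [nsmul_eq_mul] at h1
  have h3 : (addOrderOf x : ℝ) * ‖x‖ ≤ p * ‖x‖ := by gcongr
  have hpR : (0 : ℝ) < p := by exact_mod_cast hp
  have h4 : (p : ℝ) * ‖x‖ < p * (1 / p) := by gcongr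
  rw [mul_one_div_cancel hpR.ne'] at h4
  linarith

theorem UnitAddCircle.exists_nsmul_eq_zero_norm_sub_le {p : ℕ} (hp : 0 < p) (x : UnitAddCircle) :
    ∃ τ : UnitAddCircle, p • τ = 0 ∧ p * ‖x - τ‖ ≤ ‖p • x‖ := by
  have hpR : (0 : ℝ) < p := by exact_mod_cast hp
  obtain ⟨x, rfl⟩ := QuotientAddGroup.mk_surjective x
  refine ⟨((round (p * x) / p : ℝ) : UnitAddCircle), ?_, ?_⟩
  · rw [← AddCircle.coe_nsmul, nsmul_eq_mul, mul_div_cancel₀ _ hpR.ne',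
      AddCircle.coe_eq_zero_iff]
    exact ⟨round (p * x), by simp⟩
  · change p * ‖((x : ℝ) : UnitAddCircle) - _‖ ≤ ‖p • ((x : ℝ) : UnitAddCircle)‖
    rw [← AddCircle.coe_sub, ← AddCircle.coe_nsmul, nsmul_eq_mul,
      UnitAddCircle.norm_eq (x := p * x)]
    calc _ ≤ (p : ℝ) * |x - round (p * x) / p| := by
          gcongr
          exact QuotientAddGroup.norm_mk_le_norm
      _ = |(p : ℝ) * (x - round (p * x) / p)| := by rw [abs_mul, abs_of_pos hpR]
      _ = _ := by congr 1; field_simp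

theorem Int.constant_of_forall_succ {β : Type*} {u : ℤ → β} (h : ∀ n, u (n + 1) = u n) (n : ℤ) :
    u n = u 0 := by
  induction n using Int.induction_on with
  | zero => rfl
  | succ i ih => rw [h, ih]
  | pred i ih => rw [← ih, ← h (-i - 1), sub_add_cancel]

/-- A sequence with almost periodic difference, some multiple of which is almost periodic, is
almost periodic. -/
theorem IsBohrAlmostPeriodic.of_nsmul {y : ℤ → UnitAddCircle} {p : ℕ} (hp : 0 < p)
    (hpy : IsBohrAlmostPeriodic (p • y)) (hy : IsBohrAlmostPeriodic (fwdDiff 1 y)) :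
    IsBohrAlmostPeriodic y := by
  rw [isBohrAlmostPeriodic_iff] at *
  intro ε hε
  have hpR : (1 : ℝ) ≤ p := by exact_mod_cast hp
  have hpR0 : (0 : ℝ) < p := by linarith
  set κ := min (ε / 2) (1 / 4) with hκ
  have hκ0 : 0 < κ := lt_min (by positivity) (by norm_num)
  have hκ1 : κ ≤ 1 / 4 := min_le_right _ _
  have hκ2 : κ ≤ ε / 2 := min_le_left _ _
  -- Increments over m are only close to p-torsion points `τ n`; over p m these torsion parts
  -- cancel.
  refine (((hpy κ hκ0).inter (hy (1 / (4 * p)) (by positivity))).mul_left hp).mono ?_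
  rintro _ ⟨m, ⟨hm1, hm2⟩, rfl⟩ n
  choose τ hτ hτ' using fun n => UnitAddCircle.exists_nsmul_eq_zero_norm_sub_le hp (y (n + m) - y n)
  have herr : ∀ n, p * ‖y (n + m) - y n - τ n‖ < κ := fun n => by
    refine (hτ' n).trans_lt ?_
    simpa [smul_sub] using hm1 n
  have herr' : ∀ n, ‖y (n + m) - y n - τ n‖ < 1 / (4 * p) := fun n => by
    rw [lt_div_iff₀ (by positivity)]
    linarith [herr n]
  -- Distinct p-torsion points are at least 1/p apart, while `τ` moves by less than 3/(4p) per step.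
  have hconst : ∀ n, τ n = τ 0 := Int.constant_of_forall_succ fun n => by
    rw [← sub_eq_zero]
    refine UnitAddCircle.eq_zero_of_nsmul_eq_zero hp (by rw [smul_sub, hτ, hτ, sub_zero]) ?_
    have e : τ (n + 1) - τ n = (y (n + m) - y n - τ n) - (y (n + 1 + m) - y (n + 1) - τ (n + 1))
        + (fwdDiff 1 y (n + m) - fwdDiff 1 y n) := by
      simp only [fwdDiff, add_right_comm n 1 m]; abel
    rw [e]
    calc _ ≤ _ := (norm_add_le _ _).trans (add_le_add_left (norm_sub_le _ _) _)
      _ < 1 / (4 * p) + 1 / (4 * p) + 1 / (4 * p) := by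
          gcongr
          exacts [herr' _, herr' _, hm2 n]
      _ ≤ 1 / p := by
          rw [← sub_nonneg]
          have : (1 : ℝ) / p - (1 / (4 * p) + 1 / (4 * p) + 1 / (4 * p)) = 1 / (4 * p) := by
            field_simp; norm_num
          rw [this]; positivity
  have hsum : y (n + p * m) - y n =
      ∑ j ∈ Finset.range p, (y (n + j * m + m) - y (n + j * m) - τ (n + j * m)) := by
    rw [Finset.sum_sub_distrib]
    have : ∑ j ∈ Finset.range p, τ (n + j * m) = 0 := by
      refine (Finset.sum_congr rfl fun (j : ℕ) _ => hconst (n + j * m)).trans ?_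
      simp [hτ]
    rw [this, sub_zero]
    have := Finset.sum_range_sub (fun j : ℕ => y (n + j * m)) p
    simp only [Nat.cast_zero, zero_mul, add_zero] at this
    rw [← this]
    refine Finset.sum_congr rfl fun j _ => ?_
    push_cast
    rw [add_mul, one_mul, ← add_assoc]
  rw [hsum]
  calc _ ≤ ∑ j ∈ Finset.range p, ‖y (n + j * m + m) - y (n + j * m) - τ (n + j * m)‖ :=
        norm_sum_le _ _
    _ ≤ ∑ _j ∈ Finset.range p, κ / p := Finset.sum_le_sum fun j _ => by
        rw [le_div_iff₀ hpR0, mul_comm]; exact (herr _).le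
    _ = κ := by rw [Finset.sum_const, Finset.card_range, nsmul_eq_mul]; field_simp
    _ < ε := by linarith

/-! ### The Bohr compactification of `ℤ` -/

/-- The closure of the diagonal copy of `ℤ` in the product of all its characters. -/
def bohrSubgroup : AddSubgroup (UnitAddCircle → UnitAddCircle) :=
  (AddSubgroup.zmultiples (id : UnitAddCircle → UnitAddCircle)).topologicalClosure

/-- The Bohr compactification of `ℤ`. -/
abbrev BohrCompactification : Type := bohrSubgroup

namespace BohrCompactification

instance : CompactSpace BohrCompactification :=
  isCompact_iff_compactSpace.1 (AddSubgroup.isClosed_topologicalClosure _).isCompact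

/-- The image of `1` in the Bohr compactification. -/
def gen : BohrCompactification :=
  ⟨id, AddSubgroup.le_topologicalClosure _ (AddSubgroup.mem_zmultiples _)⟩

theorem zsmul_gen_apply (n : ℤ) (θ : UnitAddCircle) : (n • gen).1 θ = n • θ := rfl

theorem denseRange_zsmul_gen : DenseRange fun n : ℤ => n • gen := by
  rw [DenseRange, Subtype.dense_iff]
  intro x hx
  refine closure_mono ?_ hx
  rintro _ ⟨n, rfl⟩
  exact ⟨n • gen, ⟨n, rfl⟩, rfl⟩

theorem denseRange_nsmul_gen : DenseRange fun n : ℕ => n • gen :=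
  denseRange_zsmul_iff_nsmul.1 denseRange_zsmul_gen

theorem injective_zsmul_gen : Function.Injective fun n : ℤ => n • gen := by
  intro m n h
  have h' : ∀ θ : UnitAddCircle, m • θ = n • θ := fun θ => congrFun (congrArg Subtype.val h) θ
  by_contra hne
  have hne' : (m - n : ℤ) ≠ 0 := sub_ne_zero.2 hne
  obtain ⟨η, hη⟩ := UnitAddCircle.exists_zsmul_eq hne' ((1 / 2 : ℝ) : UnitAddCircle)
  rw [sub_smul, h', sub_self] at hη
  have := AddCircle.norm_half_period_eq (p := (1 : ℝ))
  rw [← hη] at this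
  norm_num at this

theorem containsBohrNhdZero_of_mem_nhds {V : Set BohrCompactification} (hV : V ∈ 𝓝 0) :
    ContainsBohrNhdZero {n : ℤ | n • gen ∈ V} := by
  rw [nhds_subtype, mem_comap] at hV
  obtain ⟨W, hW, hWV⟩ := hV
  rw [AddSubgroup.coe_zero, nhds_pi, Filter.mem_pi] at hW
  obtain ⟨I, hI, t, ht, htW⟩ := hW
  have h1 : ∀ i, ∃ δ > 0, Metric.ball (0 : UnitAddCircle) δ ⊆ t i := fun i =>
    Metric.mem_nhds_iff.1 (ht i)
  choose δ hδ hδt using h1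
  obtain ⟨δ', hδ', hle⟩ : ∃ δ' > 0, ∀ i ∈ hI.toFinset, δ' ≤ δ i := by
    rcases hI.toFinset.eq_empty_or_nonempty with he | hne
    · exact ⟨1, one_pos, by simp [he]⟩
    · exact ⟨hI.toFinset.inf' hne δ, (Finset.lt_inf'_iff _).2 fun i _ => hδ i,
        fun i hi => Finset.inf'_le _ hi⟩
  refine containsBohrNhdZero_iff.2 ⟨hI.toFinset, δ', hδ', fun n hn => hWV (htW fun i hi => hδt i ?_)⟩
  rw [mem_ball_zero_iff, zsmul_gen_apply]
  have hi' : i ∈ hI.toFinset := hI.mem_toFinset.2 hi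
  exact (hn i hi').trans_le (hle i hi')

theorem mem_nhds_of_finset (F : Finset UnitAddCircle) {δ : ℝ} (hδ : 0 < δ) :
    {x : BohrCompactification | ∀ θ ∈ F, ‖x.1 θ‖ < δ} ∈ 𝓝 0 := by
  have : {x : BohrCompactification | ∀ θ ∈ F, ‖x.1 θ‖ < δ} =
      ⋂ θ ∈ F, {x : BohrCompactification | ‖x.1 θ‖ < δ} := by ext; simp
  rw [this, Filter.biInter_finset_mem]
  intro θ _
  refine IsOpen.mem_nhds (isOpen_lt ?_ continuous_const) (by simpa using hδ)
  exact ((continuous_apply θ).comp continuous_subtype_val).norm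

theorem isBohrAlmostPeriodic_of_continuous {H : BohrCompactification → UnitAddCircle}
    (hH : Continuous H) : IsBohrAlmostPeriodic fun n => H (n • gen) := by
  rw [isBohrAlmostPeriodic_iff]
  intro ε hε
  have hu := CompactSpace.uniformContinuous_of_continuous hH
  have := hu (Metric.dist_mem_uniformity hε)
  rw [mem_map, uniformity_eq_comap_nhds_zero, mem_comap] at this
  obtain ⟨V, hV, hVs⟩ := this
  refine (containsBohrNhdZero_of_mem_nhds hV).mono fun m hm n => ?_
  have : (n • gen, (n + m) • gen) ∈ (fun x : BohrCompactification × BohrCompactification =>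
      x.2 - x.1) ⁻¹' V := by
    simpa [add_smul] using hm
  have h2 := hVs this
  simpa [dist_eq_norm, norm_sub_rev] using h2

/-- Integers close to a common point of the compactification differ by an almost period, so `g` is
Cauchy there and extends from the dense copy of ℤ. -/
theorem _root_.IsBohrAlmostPeriodic.exists_continuous {g : ℤ → UnitAddCircle}
    (hg : IsBohrAlmostPeriodic g) :
    ∃ φ : BohrCompactification → UnitAddCircle, Continuous φ ∧ ∀ n : ℤ, φ (n • gen) = g n := by
  rw [isBohrAlmostPeriodic_iff] at hg
  set e : ℤ → BohrCompactification := fun n => n • gen with he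
  have hinj : Function.Injective e := injective_zsmul_gen
  set g' : BohrCompactification → UnitAddCircle := fun x => g (Function.invFun e x) with hg'
  have hg'e : ∀ n, g' (e n) = g n := fun n => by
    simp only [hg', Function.leftInverse_invFun hinj n]
  have hdense : Dense (range e) := denseRange_zsmul_gen
  have hlim : ∀ x, ∃ y, Tendsto g' (𝓝[range e] x) (𝓝 y) := by
    intro x
    have : (𝓝[range e] x).NeBot := mem_closure_iff_nhdsWithin_neBot.1 (hdense x)
    have hc : Cauchy (map g' (𝓝[range e] x)) := by
      rw [Metric.cauchy_iff]
      refine ⟨inferInstance, fun ε hε => ?_⟩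
      obtain ⟨F, δ, hδ, hF⟩ := containsBohrNhdZero_iff.1 (hg ε hε)
      have hnh : {z : BohrCompactification | z - x ∈
          {x : BohrCompactification | ∀ θ ∈ F, ‖x.1 θ‖ < δ / 2}} ∈ 𝓝 x := by
        have : Tendsto (fun z => z - x) (𝓝 x) (𝓝 0) := by
          have h : Continuous fun z : BohrCompactification => z - x := by fun_prop
          simpa using h.tendsto x
        exact this (mem_nhds_of_finset F (half_pos hδ))
      refine ⟨_, image_mem_map (inter_mem (mem_nhdsWithin_of_mem_nhds hnh) self_mem_nhdsWithin), ?_⟩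
      rintro _ ⟨_, ⟨ha, ⟨a, rfl⟩⟩, rfl⟩ _ ⟨_, ⟨hb, ⟨b, rfl⟩⟩, rfl⟩
      rw [hg'e, hg'e, dist_eq_norm]
      have := hF (a - b) (fun θ hθ => ?_) b
      · simpa using this
      · have h1 := ha θ hθ
        have h2 := hb θ hθ
        have h3 : (a - b) • θ = ((e a - x).1 θ) - ((e b - x).1 θ) := by
          change _ = (a • θ - x.1 θ) - (b • θ - x.1 θ)
          rw [sub_smul]; abel
        rw [h3]
        exact (norm_sub_le _ _).trans_lt (by linarith)
    exact CompleteSpace.complete hc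
  refine ⟨extendFrom (range e) g', continuous_extendFrom hdense hlim, fun n => ?_⟩
  rw [← hg'e n]
  obtain ⟨y, hy⟩ := hlim (e n)
  refine extendFrom_eq (hdense _) ?_
  have hpure : pure (e n) ≤ 𝓝[range e] (e n) := pure_le_nhdsWithin (mem_range_self n)
  have : y = g' (e n) := tendsto_nhds_unique (hy.mono_left hpure) (tendsto_pure_nhds _ _)
  rwa [this] at hy

end BohrCompactification

/-! ### Minimal systems and circle extensions -/

/-- Forward minimality of a self-map. -/
def IsForwardMinimal {X : Type*} [TopologicalSpace X] (T : X → X) : Prop :=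
  ∀ E : Set X, IsClosed E → E.Nonempty → MapsTo T E E → E = univ

section Minimal

variable {X : Type*} [TopologicalSpace X] {T : X → X}

theorem IsForwardMinimal.exists_iterate_mem (hT : IsForwardMinimal T) (hc : Continuous T)
    {U : Set X} (hU : IsOpen U) (hne : U.Nonempty) (x : X) : ∃ n : ℕ, 0 < n ∧ T^[n] x ∈ U := by
  have hE := hT (closure (range fun n : ℕ => T^[n + 1] x)) isClosed_closure
    ((range_nonempty _).mono subset_closure) (by
      refine MapsTo.closure ?_ hc
      rintro _ ⟨n, rfl⟩
      exact ⟨n + 1, by simp only [Function.iterate_succ_apply']⟩)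
  obtain ⟨z, hz⟩ := hne
  have hz' : z ∈ closure (range fun n : ℕ => T^[n + 1] x) := hE ▸ mem_univ z
  obtain ⟨_, hy, ⟨n, rfl⟩⟩ := mem_closure_iff.1 hz' U hU hz
  exact ⟨n + 1, n.succ_pos, hy⟩

theorem IsForwardMinimal.exists_bounded_iterate_mem [CompactSpace X] (hT : IsForwardMinimal T)
    (hc : Continuous T) {U : Set X} (hU : IsOpen U) (hne : U.Nonempty) :
    ∃ N : ℕ, ∀ x, ∃ n : ℕ, 0 < n ∧ n ≤ N ∧ T^[n] x ∈ U := by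
  obtain ⟨t, ht⟩ := isCompact_univ.elim_finite_subcover
    (fun n : ℕ => T^[n + 1] ⁻¹' U) (fun n => hU.preimage (hc.iterate _)) fun x _ => by
      obtain ⟨n, hn, hx⟩ := hT.exists_iterate_mem hc hU hne x
      obtain ⟨n, rfl⟩ := Nat.exists_eq_succ_of_ne_zero hn.ne'
      exact mem_iUnion.2 ⟨n, hx⟩
  refine ⟨t.sup id + 1, fun x => ?_⟩
  obtain ⟨n, hn, hx⟩ := mem_iUnion₂.1 (ht (mem_univ x))
  exact ⟨n + 1, n.succ_pos, Nat.succ_le_succ (Finset.le_sup (f := id) hn), hx⟩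

/-- The closed nonempty forward invariant sets. -/
def closedInvariant (T : X → X) : Set (Set X) :=
  {E | IsClosed E ∧ E.Nonempty ∧ MapsTo T E E}

theorem exists_minimal_closedInvariant [CompactSpace X] {E : Set X} (hE : E ∈ closedInvariant T) :
    ∃ M, M ⊆ E ∧ Minimal (· ∈ closedInvariant T) M := by
  refine zorn_superset_nonempty _ (fun c hc hchain hne => ?_) E hE
  refine ⟨⋂₀ c, ⟨isClosed_sInter fun s hs => (hc hs).1, ?_, ?_⟩, fun s hs => sInter_subset_of_mem hs⟩
  · have := hne.to_subtype
    rw [sInter_eq_iInter]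
    refine IsCompact.nonempty_iInter_of_directed_nonempty_isCompact_isClosed _ ?_
      (fun s => (hc s.2).2.1) (fun s => (hc s.2).1.isCompact) fun s => (hc s.2).1
    rintro ⟨s, hs⟩ ⟨t, ht⟩
    rcases hchain.total hs ht with hst | hst
    · exact ⟨⟨s, hs⟩, subset_rfl, hst⟩
    · exact ⟨⟨t, ht⟩, hst, subset_rfl⟩
  · exact fun x hx s hs => (hc hs).2.2 (hx s hs)

end Minimal

section Skew

variable {X : Type*} {T : X → X} {h : X → UnitAddCircle}

/-- The skew product of `T` by the circle with cocycle `h`. -/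
def skew (T : X → X) (h : X → UnitAddCircle) (z : X × UnitAddCircle) : X × UnitAddCircle :=
  (T z.1, z.2 + h z.1)

theorem skew_iterate (n : ℕ) (z : X × UnitAddCircle) :
    (skew T h)^[n] z = (T^[n] z.1, z.2 + ∑ j ∈ Finset.range n, h (T^[j] z.1)) := by
  induction n with
  | zero => simp
  | succ n ih =>
    rw [Function.iterate_succ_apply', ih, skew, Function.iterate_succ_apply', Finset.sum_range_succ,
      add_assoc]

variable [TopologicalSpace X]

theorem continuous_skew (hT : Continuous T) (hh : Continuous h) : Continuous (skew T h) := by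
  unfold skew; fun_prop

/-- Vertical translation in a circle extension. -/
def vert (t : UnitAddCircle) (z : X × UnitAddCircle) : X × UnitAddCircle := (z.1, z.2 + t)

theorem preimage_vert_mem {M : Set (X × UnitAddCircle)} (hM : M ∈ closedInvariant (skew T h))
    (t : UnitAddCircle) : vert t ⁻¹' M ∈ closedInvariant (skew T h) := by
  obtain ⟨hc, ⟨z, hz⟩, hinv⟩ := hM
  refine ⟨hc.preimage (by unfold vert; fun_prop), ⟨vert (-t) z, by simpa [vert] using hz⟩,
    fun w hw => ?_⟩
  have := hinv hw
  simpa [skew, vert, add_right_comm] using this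

/-- Dichotomy for a circle extension of a minimal system: it is minimal, or a nonzero multiple of
the cocycle is a coboundary. -/
theorem IsForwardMinimal.skew_or_coboundary [CompactSpace X] (hT : IsForwardMinimal T) :
    IsForwardMinimal (skew T h) ∨ ∃ (p : ℕ) (H : X → UnitAddCircle), 0 < p ∧ Continuous H ∧
      ∀ x, H (T x) = H x + p • h x := by
  by_contra! hcon
  obtain ⟨hnm, hnc⟩ := hcon
  apply hnm
  intro E hEc hEne hEinv
  obtain ⟨M, hME, hMmin⟩ := exists_minimal_closedInvariant
    (show E ∈ closedInvariant (skew T h) from ⟨hEc, hEne, hEinv⟩)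
  have hM := hMmin.prop
  have hsurj : ∀ x, ∃ t, (x, t) ∈ M := by
    have := hT (Prod.fst '' M) (isClosedMap_fst_of_compactSpace _ hM.1) (hM.2.1.image _) (by
      rintro _ ⟨z, hz, rfl⟩
      exact ⟨_, hM.2.2 hz, rfl⟩)
    intro x
    obtain ⟨⟨y, t⟩, hz, rfl⟩ := (this ▸ mem_univ x : x ∈ Prod.fst '' M)
    exact ⟨t, hz⟩
  -- Vertical translations commute with the skew product, so by minimality of `M` a single pair of
  -- points differing by t makes `M` invariant under t.
  have hvert : ∀ t, (∃ z ∈ M, vert t z ∈ M) → ∀ z ∈ M, vert t z ∈ M := by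
    rintro t ⟨z, hz, hz'⟩ w hw
    have hpre := preimage_vert_mem hM t
    have hI : M ∩ vert t ⁻¹' M ∈ closedInvariant (skew T h) :=
      ⟨hM.1.inter hpre.1, ⟨z, hz, hz'⟩, fun w hw => ⟨hM.2.2 hw.1, hpre.2.2 hw.2⟩⟩
    exact (hMmin.le_of_le hI inter_subset_left hw).2
  obtain ⟨z₀, hz₀⟩ := hM.2.1
  let G : AddSubgroup UnitAddCircle :=
    { carrier := {t | ∀ z ∈ M, vert t z ∈ M}
      zero_mem' := fun z hz => by simpa [vert] using hz
      add_mem' := fun {s t} hs ht z hz => by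
        have := ht _ (hs z hz)
        simpa [vert, add_assoc] using this
      neg_mem' := fun {t} ht => hvert _ ⟨vert t z₀, ht _ hz₀, by simpa [vert] using hz₀⟩ }
  have hGc : IsClosed (G : Set UnitAddCircle) := by
    have : (G : Set UnitAddCircle) = (fun t => vert t z₀) ⁻¹' M := by
      ext t
      exact ⟨fun ht => ht _ hz₀, fun ht => hvert _ ⟨z₀, hz₀, ht⟩⟩
    rw [this]
    exact hM.1.preimage (by unfold vert; fun_prop)
  by_cases hGtop : Dense (G : Set UnitAddCircle)
  · have hall : ∀ t, t ∈ G := fun t => by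
      have := hGc.closure_eq ▸ hGtop t
      exact this
    refine eq_univ_of_forall fun ⟨x, t⟩ => hME ?_
    obtain ⟨s, hs⟩ := hsurj x
    simpa [vert] using hall (t - s) _ hs
  -- A non-dense closed subgroup is finite cyclic; multiplying by its order collapses each fibre of
  -- `M` to one value, which is the transfer function.
  · exfalso
    rw [AddCircle.dense_addSubgroup_iff_ne_zmultiples] at hGtop
    push Not at hGtop
    obtain ⟨a, ha, hGa⟩ := hGtop
    have hp : ∀ t ∈ G, addOrderOf a • t = 0 := by
      rw [hGa]
      rintro _ ⟨n, rfl⟩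
      change addOrderOf a • (n • a) = 0
      rw [smul_comm, addOrderOf_nsmul_eq_zero, smul_zero]
    choose s hs using hsurj
    have hH : ∀ x t, (x, t) ∈ M → addOrderOf a • t = addOrderOf a • s x := fun x t ht => by
      have : t - s x ∈ G := hvert _ ⟨_, hs x, by simpa [vert] using ht⟩
      rw [← sub_eq_zero, ← smul_sub, hp _ this]
    obtain ⟨x, hx⟩ := hnc (addOrderOf a) (fun x => addOrderOf a • s x) (Nat.pos_of_ne_zero ha) (by
      -- The selection `s` is arbitrary, so continuity is checked on `M` and descends along the
      -- closed surjection to `X`.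
      let π : M → X := fun z => z.1.1
      have hπ : IsQuotientMap π := by
        refine IsClosedMap.isQuotientMap ?_ (by fun_prop) fun x => ⟨⟨_, hs x⟩, rfl⟩
        exact isClosedMap_fst_of_compactSpace.comp hM.1.isClosedEmbedding_subtypeVal.isClosedMap
      rw [hπ.continuous_iff]
      have : (fun x => addOrderOf a • s x) ∘ π = fun z => addOrderOf a • z.1.2 := by
        funext z
        exact (hH z.1.1 z.1.2 z.2).symm
      rw [this]
      fun_prop)
    refine hx ?_
    rw [← smul_add]
    exact (hH _ _ (hM.2.2 (hs x))).symm

/-- Over a circle extension, no nonzero multiple of the fibre coordinate is a coboundary. -/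
theorem not_coboundary_snd [CompactSpace X] [Nonempty X] {p : ℕ} (hp : 0 < p)
    {H : X × UnitAddCircle → UnitAddCircle} (hH : Continuous H)
    (heq : ∀ z, H (skew T h z) = H z + p • z.2) : False := by
  -- Currying yields a modulus of continuity in the fibre that is uniform over the compact base.
  let A : C(UnitAddCircle, C(X, UnitAddCircle)) :=
    ContinuousMap.curry ⟨fun z : UnitAddCircle × X => H (z.2, z.1), by fun_prop⟩
  have hu := CompactSpace.uniformContinuous_of_continuous A.continuous
  obtain ⟨η, hη, hA⟩ := Metric.uniformContinuous_iff.1 hu (1 / 8) (by norm_num)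
  have hA' : ∀ x t s, ‖s‖ < η → ‖H (x, t + s) - H (x, t)‖ < 1 / 8 := fun x t s hs => by
    rw [← dist_eq_norm]
    exact (ContinuousMap.dist_apply_le_dist (f := A (t + s)) (g := A t) x).trans_lt
      (hA (by simpa [dist_eq_norm] using hs))
  have hiter : ∀ (n : ℕ) z, H ((skew T h)^[n] z) =
      H z + ∑ i ∈ Finset.range n, p • ((skew T h)^[i] z).2 := by
    intro n z
    induction n with
    | zero => simp
    | succ n ih => rw [Function.iterate_succ_apply', heq, ih, Finset.sum_range_succ, add_assoc]
  -- Moving the fibre by s adds n p s to the n-step sum, yet `H` changes by less than 1/8 at either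
  -- end. Taking s = 1/(2np) with n large is contradictory.
  have hsmall : ∀ (n : ℕ) (s : UnitAddCircle), ‖s‖ < η → ‖(n * p) • s‖ < 1 / 4 := by
    intro n s hs
    obtain ⟨x⟩ := ‹Nonempty X›
    have h1 := hiter n (x, 0 + s)
    have h2 := hiter n (x, 0)
    have h3 := hA' x 0 s hs
    have h4 := hA' (T^[n] x) (0 + ∑ j ∈ Finset.range n, h (T^[j] x)) s hs
    simp only [skew_iterate] at h1 h2
    have h5 : (n * p) • s = (H (T^[n] x, 0 + s + ∑ j ∈ Finset.range n, h (T^[j] x)) -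
        H (T^[n] x, 0 + ∑ j ∈ Finset.range n, h (T^[j] x))) - (H (x, 0 + s) - H (x, 0)) := by
      rw [h1, h2, mul_smul]
      simp only [smul_add, Finset.sum_add_distrib, Finset.sum_const, Finset.card_range, smul_zero]
      abel
    rw [h5, add_right_comm 0 s]
    exact (norm_sub_le _ _).trans_lt (by linarith)
  obtain ⟨n, hn⟩ := exists_nat_gt (1 / η)
  have hpR : (1 : ℝ) ≤ p := by exact_mod_cast hp
  have hn0 : (0 : ℝ) < n := lt_trans (by positivity) hn
  have hs : ‖((1 / 2 / (n * p) : ℝ) : UnitAddCircle)‖ < η := by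
    refine (QuotientAddGroup.norm_mk_le_norm).trans_lt ?_
    rw [Real.norm_of_nonneg (by positivity), div_lt_iff₀ (by positivity)]
    rw [div_lt_iff₀ hη] at hn
    nlinarith
  have := hsmall n _ hs
  have h6 := AddCircle.norm_half_period_eq (p := (1 : ℝ))
  rw [← AddCircle.coe_nsmul, nsmul_eq_mul, Nat.cast_mul,
    mul_div_cancel₀ _ (by positivity : (n : ℝ) * p ≠ 0), h6] at this
  norm_num at this

end Skew

/-! ### Compact systems with an observable, and their return times -/

/-- A compact system together with a circle-valued observable. -/
structure CircleSystem where
  /-- The phase space. -/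
  X : Type
  [top : TopologicalSpace X]
  [compact : CompactSpace X]
  /-- The transformation. -/
  T : X → X
  /-- The observable. -/
  h : X → UnitAddCircle
  continuous_T : Continuous T
  continuous_h : Continuous h

namespace CircleSystem

attribute [instance] CircleSystem.top CircleSystem.compact

/-- The circle extension by the observable, with the fibre coordinate as new observable. -/
def next (S : CircleSystem) : CircleSystem where
  X := S.X × UnitAddCircle
  T := skew S.T S.h
  h := Prod.snd
  continuous_T := continuous_skew S.continuous_T S.continuous_h
  continuous_h := continuous_snd

theorem minimal_next_next (S : CircleSystem) [Nonempty S.X] (h : IsForwardMinimal S.next.T) :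
    IsForwardMinimal S.next.next.T := by
  rcases h.skew_or_coboundary (h := S.next.h) with h | ⟨p, H, hp, hH, heq⟩
  · exact h
  · exact (not_coboundary_snd hp hH heq).elim

theorem next_fiber (S : CircleSystem) (x : S.X) (t : UnitAddCircle) (m : ℕ) :
    S.next.h (S.next.T^[m] (x, t)) = t + ∑ j ∈ Finset.range m, S.h (S.T^[j] x) := by
  change ((skew S.T S.h)^[m] (x, t)).2 = _
  rw [skew_iterate]

/-- Over a circle extension, the next cocycle sums take every value. -/
theorem exists_sum_next_eq_zero (S : CircleSystem) (x : S.X) {m : ℕ} (hm : 0 < m) :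
    ∃ z : S.next.X, ∑ j ∈ Finset.range m, S.next.h (S.next.T^[j] z) = 0 := by
  -- Fibre coordinate t contributes m t to the sum, and the circle is divisible.
  obtain ⟨t, ht⟩ := UnitAddCircle.exists_zsmul_eq (p := m) (by exact_mod_cast hm.ne')
    (-∑ i ∈ Finset.range m, ∑ j ∈ Finset.range i, S.h (S.T^[j] x))
  refine ⟨(x, t), ?_⟩
  simp only [next_fiber, Finset.sum_add_distrib, Finset.sum_const, Finset.card_range]
  rw [natCast_zsmul] at ht
  rw [ht, neg_add_cancel]

end CircleSystem

/-- Returns of an observable along an orbit of a minimal system form a syndetic set. -/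
theorem isSyndetic_of_minimal (S : CircleSystem) (hS : IsForwardMinimal S.T) {x : S.X}
    {f : ℤ → UnitAddCircle} (hf : ∀ n : ℕ, S.h (S.T^[n] x) = f n) {ε : ℝ} (hε : 0 < ε) :
    IsSyndeticInPosInts (posReturnTimes f ε) := by
  refine ⟨fun n hn => hn.1, ?_⟩
  have hU : IsOpen {z : S.X | ‖S.h z - f 0‖ < ε} :=
    isOpen_lt (S.continuous_h.sub continuous_const).norm continuous_const
  have h0 : S.h x = f 0 := by simpa using hf 0
  obtain ⟨N, hN⟩ := hS.exists_bounded_iterate_mem S.continuous_T hU ⟨x, by simp [h0, hε]⟩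
  refine ⟨Icc 1 N, finite_Icc _ _, fun n hn => Int.lt_of_lt_of_le zero_lt_one hn.1, fun n hn => ?_⟩
  have hn' : (0 : ℤ) < n := hn
  lift n to ℕ using hn'.le
  obtain ⟨j, hj, hjN, hmem⟩ := hN (S.T^[n] x)
  rw [← Function.iterate_add_apply] at hmem
  rw [Set.mem_sub]
  refine ⟨(j + n : ℕ), ⟨by omega, ?_⟩, j, ⟨by omega, by omega⟩, by push_cast; ring⟩
  rw [← hf]
  exact hmem

/-- Both conditions on `z` are open, so the orbit of `x` meets them at some positive time. -/
theorem mem_sub_of_minimal (S : CircleSystem) (hS : IsForwardMinimal S.T) {x : S.X}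
    {f : ℤ → UnitAddCircle} (hf : ∀ n : ℕ, S.h (S.T^[n] x) = f n) {ε : ℝ} {m : ℕ} {z : S.X}
    (h1 : ‖S.h z - f 0‖ < ε) (h2 : ‖S.h (S.T^[m] z) - f 0‖ < ε) :
    (m : ℤ) ∈ posReturnTimes f ε - posReturnTimes f ε := by
  have hU : IsOpen {z : S.X | ‖S.h z - f 0‖ < ε ∧ ‖S.h (S.T^[m] z) - f 0‖ < ε} :=
    (isOpen_lt (S.continuous_h.sub continuous_const).norm continuous_const).inter
      (isOpen_lt ((S.continuous_h.comp (S.continuous_T.iterate m)).sub continuous_const).norm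
        continuous_const)
  obtain ⟨n, hn, hn1, hn2⟩ := hS.exists_iterate_mem S.continuous_T hU ⟨z, h1, h2⟩ x
  rw [← Function.iterate_add_apply] at hn2
  rw [Set.mem_sub]
  refine ⟨(m + n : ℕ), ⟨by omega, ?_⟩, n, ⟨by omega, ?_⟩, by push_cast; ring⟩
  · rw [← hf]; exact hn2
  · rw [← hf]; exact hn1

theorem containsBohrNhdZero_sub_self {A V : Set ℤ} (hV : ContainsBohrNhdZero V)
    (h : ∀ m : ℕ, (m : ℤ) ∈ V → (m : ℤ) ∈ A - A) : ContainsBohrNhdZero (A - A) := by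
  refine hV.inter_neg.mono ?_
  rintro n ⟨hn, hn'⟩
  obtain ⟨m, rfl | rfl⟩ := n.eq_nat_or_neg
  · exact h m hn
  · obtain ⟨a, ha, b, hb, hab⟩ := Set.mem_sub.1 (h m (by simpa using hn'))
    exact Set.mem_sub.2 ⟨b, hb, a, ha, by rw [← hab]; ring⟩

/-! ### Invariant means and real lifts -/

/-- Boundedness of a real sequence indexed by `ℤ`. -/
def IsBoundedSeq (F : ℤ → ℝ) : Prop := ∃ C, ∀ n, |F n| ≤ C

theorem IsBoundedSeq.add {F G : ℤ → ℝ} (hF : IsBoundedSeq F) (hG : IsBoundedSeq G) :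
    IsBoundedSeq (F + G) := by
  obtain ⟨C, hC⟩ := hF
  obtain ⟨D, hD⟩ := hG
  exact ⟨C + D, fun n => (abs_add_le _ _).trans (add_le_add (hC n) (hD n))⟩

theorem IsBoundedSeq.neg {F : ℤ → ℝ} (hF : IsBoundedSeq F) : IsBoundedSeq (-F) := by
  obtain ⟨C, hC⟩ := hF
  exact ⟨C, fun n => by simpa using hC n⟩

theorem IsBoundedSeq.comp {F : ℤ → ℝ} (hF : IsBoundedSeq F) (σ : ℤ → ℤ) :
    IsBoundedSeq fun n => F (σ n) := by
  obtain ⟨C, hC⟩ := hF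
  exact ⟨C, fun n => hC _⟩

/-- An invariant mean on bounded sequences indexed by `ℤ`. -/
structure InvariantMean (M : (ℤ → ℝ) → ℝ) : Prop where
  add : ∀ {F G}, IsBoundedSeq F → IsBoundedSeq G → M (F + G) = M F + M G
  le : ∀ {F C}, IsBoundedSeq F → (∀ n, F n ≤ C) → M F ≤ C
  const : ∀ c, M (fun _ => c) = c
  shift : ∀ {F}, IsBoundedSeq F → ∀ j, M (fun n => F (n + j)) = M F

/-- Cesàro averages are taken to their limit along a nonprincipal ultrafilter; a unit shift changes
them by O(1/N). -/
theorem exists_invariantMean : ∃ M, InvariantMean M := by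
  let avg : (ℤ → ℝ) → ℕ → ℝ := fun F N => (∑ i ∈ Finset.range N, F i) / N
  have habs : ∀ {F C}, (∀ n, |F n| ≤ C) → ∀ N, avg F N ∈ Icc (-C) C := by
    intro F C hC N
    have hC0 : 0 ≤ C := (abs_nonneg _).trans (hC 0)
    rw [mem_Icc, ← abs_le, abs_div, Nat.abs_cast]
    refine div_le_of_le_mul₀ (by positivity) hC0 ?_
    calc _ ≤ ∑ i ∈ Finset.range N, |F i| := Finset.abs_sum_le_sum_abs _ _
      _ ≤ ∑ _i ∈ Finset.range N, C := Finset.sum_le_sum fun i _ => hC i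
      _ = C * N := by rw [Finset.sum_const, Finset.card_range, nsmul_eq_mul, mul_comm]
  have hex : ∀ F, IsBoundedSeq F → ∃ a, Tendsto (avg F) (hyperfilter ℕ : Filter ℕ) (𝓝 a) := by
    rintro F ⟨C, hC⟩
    obtain ⟨a, -, ha⟩ := isCompact_Icc.ultrafilter_le_nhds ((hyperfilter ℕ).map (avg F))
      (le_principal_iff.2 (Filter.mem_map.2 (Filter.univ_mem' (habs hC))))
    exact ⟨a, ha⟩
  choose! M hM using hex
  have hM_eq : ∀ {F a}, IsBoundedSeq F → Tendsto (avg F) (hyperfilter ℕ : Filter ℕ) (𝓝 a) →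
      M F = a := fun hF h => tendsto_nhds_unique (hM _ hF) h
  have hpos : ∀ᶠ N : ℕ in (hyperfilter ℕ : Filter ℕ), 0 < N :=
    Nat.hyperfilter_le_atTop (eventually_gt_atTop 0)
  have hshift1 : ∀ {F}, IsBoundedSeq F → M (fun n => F (n + 1)) = M F := by
    intro F hF
    refine hM_eq (hF.comp _) ?_
    obtain ⟨C, hC⟩ := hF
    have h0 : Tendsto (fun N : ℕ => (F N - F 0) / N) (hyperfilter ℕ : Filter ℕ) (𝓝 0) := by
      have h1 : Tendsto (fun N : ℕ => (2 * C) / (N : ℝ)) (hyperfilter ℕ : Filter ℕ) (𝓝 0) :=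
        (tendsto_const_div_atTop_nhds_zero_nat _).mono_left Nat.hyperfilter_le_atTop
      refine squeeze_zero_norm (fun N => ?_) h1
      rw [norm_div, Real.norm_natCast, Real.norm_eq_abs]
      gcongr
      exact (abs_sub _ _).trans (by linarith [hC N, hC 0])
    have := (hM F ⟨C, hC⟩).add h0
    rw [add_zero] at this
    refine this.congr fun N => ?_
    have hs := Finset.sum_range_sub (fun i : ℕ => F i) N
    rw [Finset.sum_sub_distrib] at hs
    simp only [avg]
    push_cast at hs
    rw [← hs]
    ring
  refine ⟨M, ⟨fun {F G} hF hG => hM_eq (hF.add hG) ?_, fun {F C} hF hC => ?_,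
    fun c => hM_eq ⟨|c|, fun _ => le_rfl⟩ ?_,
    fun {F} hF j => ?_⟩⟩
  · refine ((hM F hF).add (hM G hG)).congr fun N => ?_
    simp [avg, Finset.sum_add_distrib, add_div]
  · refine le_of_tendsto (hM F hF) (hpos.mono fun N hN => ?_)
    have hN' : (0 : ℝ) < N := by exact_mod_cast hN
    rw [div_le_iff₀ hN']
    calc _ ≤ ∑ _i ∈ Finset.range N, C := Finset.sum_le_sum fun i _ => hC i
      _ = C * N := by rw [Finset.sum_const, Finset.card_range, nsmul_eq_mul, mul_comm]
  · refine tendsto_const_nhds.congr' (hpos.mono fun N hN => ?_)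
    have hN' : (0 : ℝ) < N := by exact_mod_cast hN
    simp only [avg, Finset.sum_const, Finset.card_range, nsmul_eq_mul]
    field_simp
  · induction j using Int.induction_on with
    | zero => simp
    | succ i ih =>
      rw [← ih, ← hshift1 (hF.comp fun n => n + i)]
      simp only [add_assoc, add_comm (1 : ℤ)]
    | pred i ih =>
      rw [← ih, ← hshift1 (hF.comp fun n => n + (-i - 1))]
      congr 1
      funext n
      congr 1
      ring

namespace InvariantMean

variable {M : (ℤ → ℝ) → ℝ}

theorem neg (hM : InvariantMean M) {F : ℤ → ℝ} (hF : IsBoundedSeq F) : M (-F) = -M F := by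
  have h := hM.add hF hF.neg
  have h0 : F + -F = fun _ => (0 : ℝ) := by funext n; simp
  rw [h0, hM.const] at h
  linarith

theorem ge (hM : InvariantMean M) {F : ℤ → ℝ} {C : ℝ} (hF : IsBoundedSeq F) (h : ∀ n, C ≤ F n) :
    C ≤ M F := by
  have := hM.le hF.neg (C := -C) fun n => by simpa using h n
  rw [hM.neg hF] at this
  linarith

theorem shift_sub (hM : InvariantMean M) {F : ℤ → ℝ} (hF : IsBoundedSeq F) (j : ℤ) :
    M (fun n => F (n + j) - F n) = 0 := by
  have h := hM.add (hF.comp fun n => n + j) hF.neg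
  rw [hM.shift hF, hM.neg hF, add_neg_cancel] at h
  exact h

end InvariantMean

namespace UnitAddCircle

theorem norm_coe_of_abs_le {x : ℝ} (hx : |x| ≤ 1 / 2) : ‖(x : UnitAddCircle)‖ = |x| :=
  (AddCircle.norm_coe_eq_abs_iff (p := (1 : ℝ)) one_ne_zero).2 (by simpa using hx)

theorem norm_coe_le (x : ℝ) : ‖(x : UnitAddCircle)‖ ≤ |x| := QuotientAddGroup.norm_mk_le_norm

theorem exists_lift (t : UnitAddCircle) : ∃ x : ℝ, (x : UnitAddCircle) = t ∧ |x| = ‖t‖ := by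
  obtain ⟨x, rfl⟩ := QuotientAddGroup.mk_surjective t
  refine ⟨x - round x, ?_, (UnitAddCircle.norm_eq).symm⟩
  have : ((round x : ℝ) : UnitAddCircle) = 0 :=
    (AddCircle.coe_eq_zero_iff 1).2 ⟨round x, by simp⟩
  rw [AddCircle.coe_sub, this, sub_zero]

theorem coe_eq_zero {x : ℝ} (hx : (x : UnitAddCircle) = 0) : ∃ n : ℤ, x = n := by
  obtain ⟨n, hn⟩ := (AddCircle.coe_eq_zero_iff 1).1 hx
  exact ⟨n, by simpa using hn.symm⟩

theorem coe_int (n : ℤ) : ((n : ℝ) : UnitAddCircle) = 0 :=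
  (AddCircle.coe_eq_zero_iff 1).2 ⟨n, by simp⟩

end UnitAddCircle

theorem exists_primitive (r : ℤ → ℝ) (a : ℝ) :
    ∃ s : ℤ → ℝ, s 0 = a ∧ ∀ n, s (n + 1) - s n = r n := by
  refine ⟨fun n => match n with
    | Int.ofNat k => a + ∑ i ∈ Finset.range k, r i
    | Int.negSucc k => a - ∑ i ∈ Finset.range (k + 1), r (Int.negSucc i), by simp, ?_⟩
  rintro (k | k)
  · change (a + ∑ i ∈ Finset.range (k + 1), r i) - (a + ∑ i ∈ Finset.range k, r i) = _
    rw [Finset.sum_range_succ]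
    simp
  · cases k with
    | zero =>
      change (a + ∑ i ∈ Finset.range 0, r i) - (a - ∑ i ∈ Finset.range 1, r (Int.negSucc i)) = _
      simp
    | succ k =>
      change (a - ∑ i ∈ Finset.range (k + 1), r (Int.negSucc i)) -
        (a - ∑ i ∈ Finset.range (k + 1 + 1), r (Int.negSucc i)) = _
      rw [Finset.sum_range_succ _ (k + 1)]
      ring

theorem exists_slow_lift {u : ℤ → UnitAddCircle} {ε : ℝ} (hu : ∀ n, ‖u (n + 1) - u n‖ < ε) :
    ∃ s : ℤ → ℝ, (∀ n, (s n : UnitAddCircle) = u n) ∧ ∀ n, |s (n + 1) - s n| < ε := by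
  choose r hr hr' using fun n => UnitAddCircle.exists_lift (u (n + 1) - u n)
  obtain ⟨a, ha, -⟩ := UnitAddCircle.exists_lift (u 0)
  obtain ⟨s, hs0, hs⟩ := exists_primitive r a
  refine ⟨s, fun n => ?_, fun n => by rw [hs, hr']; exact hu n⟩
  have := Int.constant_of_forall_succ (u := fun n => (s n : UnitAddCircle) - u n) (fun n => by
    have h := hr n
    rw [← hs, AddCircle.coe_sub] at h
    rw [sub_eq_sub_iff_sub_eq_sub]
    exact h) n
  simp only [hs0, ha, sub_self] at this
  exact sub_eq_zero.1 this

/-- A slowly varying real sequence that avoids a neighbourhood of `c` stays on one side of it. -/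
theorem le_or_ge_of_avoid {s : ℤ → ℝ} {ε c : ℝ} (hs : ∀ n, |s (n + 1) - s n| < ε)
    (h : ∀ n, ε ≤ |s n - c|) : (∀ n, s n ≤ c - ε) ∨ ∀ n, c + ε ≤ s n := by
  have hε : 0 < ε := (abs_nonneg _).trans_lt (hs 0)
  have hside : ∀ n, s n < c ∨ c < s n → (s n < c → s n ≤ c - ε) ∧ (c < s n → c + ε ≤ s n) :=
    fun n _ => ⟨fun hn => by have := h n; rw [abs_of_neg (by linarith)] at this; linarith,
      fun hn => by have := h n; rw [abs_of_pos (by linarith)] at this; linarith⟩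
  have hne : ∀ n, s n < c ∨ c < s n := fun n => by
    refine lt_or_gt_of_ne fun he => ?_
    have := h n
    rw [he, sub_self, abs_zero] at this
    linarith
  have hconst : ∀ n, (s n < c) = (s 0 < c) := Int.constant_of_forall_succ fun n => by
    have h1 := abs_lt.1 (hs n)
    refine propext ⟨fun hlt => ?_, fun hlt => ?_⟩
    · have := (hside _ (hne _)).1 hlt
      linarith
    · have := (hside _ (hne _)).1 hlt
      linarith
  rcases hne 0 with h0 | h0
  · exact Or.inl fun n => (hside n (hne n)).1 ((hconst n).symm ▸ h0)
  · refine Or.inr fun n => (hside n (hne n)).2 ((hne n).resolve_left fun hn => ?_)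
    have : s 0 < c := (hconst n) ▸ hn
    linarith

/-- Steps are too short to jump over an integer, so the sequence stays in the unit interval where it
starts. -/
theorem isBoundedSeq_of_avoid {s : ℤ → ℝ} {ε : ℝ} (hs : ∀ n, |s (n + 1) - s n| < ε)
    (h : ∀ n, ε ≤ ‖(s n : UnitAddCircle)‖) : IsBoundedSeq s := by
  have hav : ∀ c : ℤ, ∀ n, ε ≤ |s n - c| := fun c n => by
    refine (h n).trans ?_
    have : (s n : UnitAddCircle) = ((s n - c : ℝ) : UnitAddCircle) := by
      rw [AddCircle.coe_sub, UnitAddCircle.coe_int, sub_zero]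
    rw [this]
    exact UnitAddCircle.norm_coe_le _
  have hε : 0 < ε := (abs_nonneg _).trans_lt (hs 0)
  have h1 := (le_or_ge_of_avoid hs (hav ⌊s 0⌋)).resolve_left fun h => by
    linarith [h 0, Int.floor_le (s 0)]
  have h2 := (le_or_ge_of_avoid hs (hav (⌊s 0⌋ + 1))).resolve_right fun h => by
    have := h 0
    push_cast at this
    linarith [Int.lt_floor_add_one (s 0)]
  refine ⟨max |(⌊s 0⌋ : ℝ)| |((⌊s 0⌋ + 1 : ℤ) : ℝ)|, fun n => ?_⟩
  exact abs_le_max_abs_abs (by linarith [h1 n]) (by linarith [h2 n])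

/-! ### Recurrence of sequences with almost periodic difference -/

/-- A bounded, slowly varying real lift of `n ↦ y (n + m) - y n`. -/
structure IsTameLift (y : ℤ → UnitAddCircle) (m : ℤ) (s : ℤ → ℝ) : Prop where
  bounded : IsBoundedSeq s
  coe : ∀ n, (s n : UnitAddCircle) = y (n + m) - y n
  slow : ∀ n, |s (n + 1) - s n| < 1 / 8

/-- Both sides lift the same second difference of `y`, so they differ by an integer. Slowness makes
it constant in n, and shift invariance of a mean makes the constant zero. -/
theorem IsTameLift.comm {y : ℤ → UnitAddCircle} {m b : ℤ} {s t : ℤ → ℝ} (hs : IsTameLift y m s)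
    (ht : IsTameLift y b t) (n : ℤ) : s (n + b) - s n = t (n + m) - t n := by
  obtain ⟨M, hM⟩ := exists_invariantMean
  set D : ℤ → ℝ := fun n => (s (n + b) - s n) - (t (n + m) - t n) with hD
  have hint : ∀ n, ∃ k : ℤ, D n = k := fun n => UnitAddCircle.coe_eq_zero (by
    simp only [hD, AddCircle.coe_sub, hs.coe, ht.coe, add_right_comm n b m]
    abel)
  choose k hk using hint
  have hconst : ∀ n, k n = k 0 := Int.constant_of_forall_succ fun n => by
    have h1 : |D (n + 1) - D n| < 1 := by
      have e : D (n + 1) - D n = (s (n + b + 1) - s (n + b)) - (s (n + 1) - s n)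
          - ((t (n + m + 1) - t (n + m)) - (t (n + 1) - t n)) := by
        simp only [hD, add_right_comm n 1]; ring
      rw [e]
      have a1 := abs_lt.1 (hs.slow (n + b))
      have a2 := abs_lt.1 (hs.slow n)
      have a3 := abs_lt.1 (ht.slow (n + m))
      have a4 := abs_lt.1 (ht.slow n)
      rw [abs_lt]
      constructor <;> linarith
    rw [hk, hk] at h1
    have h2 : |k (n + 1) - k n| < 1 := by exact_mod_cast h1
    rw [Int.abs_lt_one_iff] at h2
    linarith
  have hDc : D = fun _ => (k 0 : ℝ) := by funext n; rw [hk, hconst]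
  have hsb : IsBoundedSeq fun n => s (n + b) - s n := (hs.bounded.comp _).add hs.bounded.neg
  have htb : IsBoundedSeq fun n => t (n + m) - t n := (ht.bounded.comp _).add ht.bounded.neg
  have h0 : M D = 0 := by
    have := hM.add hsb htb.neg
    rw [hM.neg htb, hM.shift_sub hs.bounded, hM.shift_sub ht.bounded] at this
    have e : D = (fun n => s (n + b) - s n) + -fun n => t (n + m) - t n := by
      funext n; simp only [hD, Pi.add_apply, Pi.neg_apply]; ring
    rw [e, this, neg_zero, add_zero]
  rw [hDc, hM.const] at h0
  have := congrFun hDc n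
  rw [h0] at this
  exact sub_eq_zero.1 this

/-- The mean of the tame lifts along the group generated by their indices is a character. -/
theorem exists_character_of_tameLift {y : ℤ → UnitAddCircle} {Λ : Set ℤ} {s : ℤ → ℤ → ℝ}
    (hs : ∀ m ∈ Λ, IsTameLift y m (s m)) {M : (ℤ → ℝ) → ℝ} (hM : InvariantMean M) :
    ∃ (q : ℤ) (θ : UnitAddCircle), ∀ m ∈ Λ, (M fun i => s m (q * i) : UnitAddCircle) = m • θ := by
  -- Averaging along q ℤ turns translations by the group generated by `Λ` into index shifts, and
  -- makes `Λ`-periodic sequences constant there.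
  obtain ⟨q, hq⟩ := Int.subgroup_cyclic (AddSubgroup.closure Λ)
  have hdvd : ∀ m, m ∈ AddSubgroup.closure Λ ↔ q ∣ m := fun m => by
    rw [hq, AddSubgroup.mem_closure_singleton]
    simp [dvd_def, mul_comm, eq_comm]
  let β : ℤ → UnitAddCircle := fun m => (M fun i => s m (q * i) : ℝ)
  let Γ : AddSubgroup (ℤ × UnitAddCircle) := AddSubgroup.closure ((fun m => (m, β m)) '' Λ)
  -- `Γ` will be the graph of a homomorphism. Slowness of lifts is lost under sums; their
  -- commutation with the tame lifts is not, and is carried along instead.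
  have hΓ : ∀ z ∈ Γ, q ∣ z.1 ∧ ∃ R : ℤ → ℝ, IsBoundedSeq R ∧
      (∀ n, (R n : UnitAddCircle) = y (n + z.1) - y n) ∧
      ((M fun i => R (q * i) : ℝ) : UnitAddCircle) = z.2 ∧
      ∀ b ∈ Λ, ∀ n, R (n + b) - R n = s b (n + z.1) - s b n := by
    intro z hz
    induction hz using AddSubgroup.closure_induction with
    | mem z hz =>
      obtain ⟨m, hm, rfl⟩ := hz
      exact ⟨(hdvd m).1 (AddSubgroup.subset_closure hm), s m, (hs m hm).bounded, (hs m hm).coe, rfl,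
        fun b hb n => (hs m hm).comm (hs b hb) n⟩
    | zero =>
      refine ⟨dvd_zero _, fun _ => 0, ⟨0, by simp⟩, by simp, ?_, by simp⟩
      rw [hM.const]; simp
    | add z w _ _ hz hw =>
      obtain ⟨hqz, R, hRb, hR, hRM, hRΛ⟩ := hz
      obtain ⟨hqw, R', hRb', hR', hRM', hRΛ'⟩ := hw
      obtain ⟨j, hj⟩ := hqz
      refine ⟨dvd_add ⟨j, hj⟩ hqw, R + fun n => R' (n + z.1), hRb.add (hRb'.comp _),
        fun n => ?_, ?_, fun b hb n => ?_⟩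
      · simp only [Pi.add_apply, AddCircle.coe_add, hR, hR', Prod.fst_add, ← add_assoc]
        abel
      · have h1 : (fun i => (R + fun n => R' (n + z.1)) (q * i)) =
            (fun i => R (q * i)) + fun i => R' (q * (i + j)) := by
          funext i
          simp only [Pi.add_apply, hj, mul_add]
        have h2 := hM.shift (hRb'.comp fun i => q * i) j
        rw [h1, hM.add (hRb.comp _) (hRb'.comp _), h2, AddCircle.coe_add, hRM, hRM']
        rfl
      · have h1 := hRΛ b hb n
        have h2 := hRΛ' b hb (n + z.1)
        simp only [Pi.add_apply, Prod.fst_add, ← add_assoc, add_right_comm n b z.1] at *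
        linarith
    | neg z _ hz =>
      obtain ⟨hqz, R, hRb, hR, hRM, hRΛ⟩ := hz
      obtain ⟨j, hj⟩ := hqz
      refine ⟨(dvd_neg.2 ⟨j, hj⟩ : q ∣ -z.1), -fun n => R (n + -z.1), (hRb.comp _).neg, fun n => ?_,
        ?_, fun b hb n => ?_⟩
      · simp [hR]
      · have h1 : (fun i => (-fun n => R (n + -z.1)) (q * i)) = -fun i => R (q * (i + -j)) := by
          funext i
          simp only [Pi.neg_apply, hj]
          congr 2
          ring
        have h2 := hM.shift (hRb.comp fun i => q * i) (-j)
        rw [h1, hM.neg (hRb.comp _), h2, AddCircle.coe_neg, hRM]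
        rfl
      · have h1 := hRΛ b hb (n + -z.1)
        simp only [Pi.neg_apply, Prod.fst_neg, neg_add_cancel_right, add_right_comm n b] at *
        linarith
  -- Over 0 commutation makes `R` periodic under `Λ`, so its mean along q ℤ is `R 0`, an integer.
  have hzero : ∀ t, ((0 : ℤ), t) ∈ Γ → t = 0 := by
    intro t ht
    obtain ⟨-, R, -, hR, hRM, hRΛ⟩ := hΓ _ ht
    simp only [add_zero, sub_self] at hR hRΛ
    have hper : ∀ b ∈ AddSubgroup.closure Λ, ∀ n, R (n + b) = R n := by
      intro b hb
      induction hb using AddSubgroup.closure_induction with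
      | mem b hb => exact fun n => sub_eq_zero.1 (hRΛ b hb n)
      | zero => simp
      | add b c _ _ h h' => intro n; rw [← add_assoc, h', h]
      | neg b _ h => intro n; rw [← h, neg_add_cancel_right]
    have hc : (fun i => R (q * i)) = fun _ => R 0 := by
      funext i
      have := hper (q * i) ((hdvd _).2 (dvd_mul_right _ _)) 0
      rwa [zero_add] at this
    rw [hc, hM.const] at hRM
    exact hRM.symm.trans (hR 0)
  have hproj : ∀ m ∈ AddSubgroup.closure Λ, ∃ t, (m, t) ∈ Γ := by
    intro m hm
    induction hm using AddSubgroup.closure_induction with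
    | mem m hm => exact ⟨β m, AddSubgroup.subset_closure ⟨m, hm, rfl⟩⟩
    | zero => exact ⟨0, Γ.zero_mem⟩
    | add m n _ _ h h' =>
      obtain ⟨t, ht⟩ := h
      obtain ⟨t', ht'⟩ := h'
      exact ⟨t + t', Γ.add_mem ht ht'⟩
    | neg m _ h =>
      obtain ⟨t, ht⟩ := h
      exact ⟨-t, Γ.neg_mem ht⟩
  obtain ⟨θ₀, hθ₀⟩ := hproj q ((hdvd q).2 dvd_rfl)
  obtain ⟨θ, hθ⟩ : ∃ θ : UnitAddCircle, q • θ = θ₀ := by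
    rcases eq_or_ne q 0 with h | h
    · refine ⟨0, ?_⟩
      rw [smul_zero, hzero θ₀ (h ▸ hθ₀)]
    · exact UnitAddCircle.exists_zsmul_eq h θ₀
  refine ⟨q, θ, fun m hm => ?_⟩
  obtain ⟨j, hj⟩ := (hdvd m).1 (AddSubgroup.subset_closure hm)
  have h1 : (m, β m) ∈ Γ := AddSubgroup.subset_closure ⟨m, hm, rfl⟩
  have h2 := hzero (β m - j • θ₀) (by
    have := Γ.sub_mem h1 (Γ.zsmul_mem hθ₀ j)
    have e : (m, β m) - j • (q, θ₀) = ((0 : ℤ), β m - j • θ₀) := by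
      ext
      · simp [hj, mul_comm]
      · simp
    rwa [e] at this)
  change β m = _
  rw [sub_eq_zero.1 h2, ← hθ, smul_smul, hj, mul_comm]

/-- A sequence with almost periodic difference nearly returns at every element of some Bohr
neighbourhood of zero. -/
theorem IsBohrAlmostPeriodic.exists_return {y : ℤ → UnitAddCircle}
    (hy : IsBohrAlmostPeriodic (fwdDiff 1 y)) {ε : ℝ} (hε : 0 < ε) :
    ContainsBohrNhdZero {m : ℤ | ∃ n, ‖y (n + m) - y n‖ < ε} := by
  obtain ⟨M, hM⟩ := exists_invariantMean
  rw [isBohrAlmostPeriodic_iff] at hy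
  set κ := min (ε / 2) (1 / 8) with hκ
  have hκ0 : 0 < κ := lt_min (by positivity) (by norm_num)
  have hκ1 : κ ≤ 1 / 8 := min_le_right _ _
  have hκ2 : κ ≤ ε / 2 := min_le_left _ _
  -- The character has to be fixed before m, so lifts are chosen for all tame indices at once; 0 is
  -- a dummy value elsewhere.
  have hs : ∀ m, ∃ s, m ∈ {m | ∃ s, IsTameLift y m s} → IsTameLift y m s := fun m => by
    by_cases h : ∃ s, IsTameLift y m s
    · exact ⟨h.choose, fun _ => h.choose_spec⟩
    · exact ⟨0, fun h' => (h h').elim⟩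
  choose s hs using hs
  obtain ⟨q, θ, hθ⟩ := exists_character_of_tameLift hs hM
  refine ((hy κ hκ0).inter (containsBohrNhdZero_character θ hκ0)).mono ?_
  rintro m ⟨hm1, hm2⟩
  have hstep : ∀ n, ‖(y (n + 1 + m) - y (n + 1)) - (y (n + m) - y n)‖ < κ := fun n => by
    have e : (y (n + 1 + m) - y (n + 1)) - (y (n + m) - y n) =
        fwdDiff 1 y (n + m) - fwdDiff 1 y n := by
      simp only [fwdDiff, add_right_comm n 1 m]; abel
    rw [e]
    exact hm1 n
  by_contra hcon
  have hav : ∀ n, ε ≤ ‖y (n + m) - y n‖ := fun n => not_lt.1 fun h => hcon ⟨n, h⟩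
  have hmem : m ∈ {m | ∃ s, IsTameLift y m s} := by
    obtain ⟨r, hr, hr'⟩ := exists_slow_lift (u := fun n => y (n + m) - y n) hstep
    refine ⟨r, isBoundedSeq_of_avoid hr' fun n => ?_, hr, fun n => (hr' n).trans_le hκ1⟩
    rw [hr]
    linarith [hav n]
  have hsm := hs m hmem
  -- The chosen lift is only known to have steps below 1/8; at that size absolute value and circle
  -- norm agree, which recovers κ.
  have hslow : ∀ n, |s m (n + 1) - s m n| < κ := fun n => by
    rw [← UnitAddCircle.norm_coe_of_abs_le ((hsm.slow n).le.trans (by norm_num)),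
      AddCircle.coe_sub, hsm.coe, hsm.coe]
    exact hstep n
  set μ := M fun i => s m (q * i) with hμ
  have hμθ : ‖(μ : UnitAddCircle)‖ < κ := by
    rw [hμ, hθ m hmem]
    exact hm2
  have hfar : ∀ n, κ ≤ |s m n - μ| := fun n => by
    have h1 := hav n
    rw [← hsm.coe] at h1
    have h2 : ‖(s m n : UnitAddCircle)‖ ≤ |s m n - μ| + ‖(μ : UnitAddCircle)‖ := by
      refine le_trans ?_ (add_le_add_left (UnitAddCircle.norm_coe_le _) _)
      rw [AddCircle.coe_sub]
      simpa using norm_add_le ((s m n : UnitAddCircle) - μ) μ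
    linarith
  have hb : IsBoundedSeq fun i => s m (q * i) := hsm.bounded.comp _
  rcases le_or_ge_of_avoid hslow hfar with h | h
  · linarith [hM.le hb fun i => h (q * i)]
  · linarith [hM.ge hb fun i => h (q * i)]

/-! ### Towers of circle extensions of the Bohr compactification -/

namespace BohrCompactification

theorem iterate_add_gen (n : ℕ) (x : BohrCompactification) : (· + gen)^[n] x = x + n • gen := by
  rw [add_right_iterate]

theorem isForwardMinimal : IsForwardMinimal fun x : BohrCompactification => x + gen := by
  intro E hE ⟨x, hx⟩ hinv
  refine eq_univ_of_forall fun z => ?_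
  have hd : z - x ∈ closure (range fun n : ℕ => n • gen) := denseRange_nsmul_gen _
  have hcl : IsClosed {w : BohrCompactification | x + w ∈ E} := hE.preimage (by fun_prop)
  have : closure (range fun n : ℕ => n • gen) ⊆ {w : BohrCompactification | x + w ∈ E} := by
    refine closure_minimal ?_ hcl
    rintro _ ⟨n, rfl⟩
    have := hinv.iterate n hx
    rwa [iterate_add_gen] at this
  simpa using this hd

end BohrCompactification

open BohrCompactification

/-- The rotation of the Bohr compactification with a continuous observable. -/
def rotationSystem (φ : BohrCompactification → UnitAddCircle) (hφ : Continuous φ) :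
    CircleSystem where
  X := BohrCompactification
  T := fun x => x + gen
  h := φ
  continuous_T := by fun_prop
  continuous_h := hφ

theorem sum_range_fwdDiff (y : ℤ → UnitAddCircle) (n : ℤ) (m : ℕ) :
    ∑ j ∈ Finset.range m, fwdDiff 1 y (n + j) = y (n + m) - y n := by
  have := Finset.sum_range_sub (fun j : ℕ => y (n + j)) m
  simp only [Nat.cast_zero, add_zero] at this
  rw [← this]
  refine Finset.sum_congr rfl fun j _ => ?_
  simp only [fwdDiff, Nat.cast_add, Nat.cast_one, add_assoc]

/-- If no nonzero multiple of `y` is almost periodic, the circle extension associated with its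
almost periodic difference is minimal. -/
theorem isForwardMinimal_next_rotationSystem {y : ℤ → UnitAddCircle}
    {φ : BohrCompactification → UnitAddCircle} (hφ : Continuous φ)
    (hφy : ∀ n : ℤ, φ (n • gen) = fwdDiff 1 y n)
    (hy : ∀ p : ℕ, 0 < p → ¬ IsBohrAlmostPeriodic (p • y)) :
    IsForwardMinimal (rotationSystem φ hφ).next.T := by
  rcases BohrCompactification.isForwardMinimal.skew_or_coboundary (h := φ) with h | ⟨p, H, hp, hH, heq⟩
  · exact h
  · refine (hy p hp ?_).elim
    have hconst : ∀ n, H (n • gen) - p • y n = H ((0 : ℤ) • gen) - p • y 0 :=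
      Int.constant_of_forall_succ fun n => by
        rw [add_smul, one_smul, heq, hφy, fwdDiff, smul_sub]
        abel
    have hap := isBohrAlmostPeriodic_of_continuous hH
    rw [isBohrAlmostPeriodic_iff] at hap ⊢
    refine fun ε hε => (hap ε hε).mono fun m hm n => ?_
    have e : (p • y) (n + m) - (p • y) n = H ((n + m) • gen) - H (n • gen) := by
      have h1 := hconst (n + m)
      rw [← hconst n] at h1
      simp only [Pi.smul_apply]
      rw [sub_eq_sub_iff_sub_eq_sub] at h1
      exact h1.symm
    rw [e]
    exact hm n

/-- The orbit realisation of `f` by an iterated circle extension. -/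
theorem exists_point_iterate_next (S : CircleSystem) (x : S.X) (i : ℕ) (f : ℤ → UnitAddCircle)
    (hx : ∀ n : ℕ, S.h (S.T^[n] x) = (fwdDiff (1 : ℤ))^[i] f n) :
    ∃ z : (CircleSystem.next^[i] S).X, ∀ n : ℕ,
      (CircleSystem.next^[i] S).h ((CircleSystem.next^[i] S).T^[n] z) = f n := by
  induction i generalizing f with
  | zero => exact ⟨x, hx⟩
  | succ i ih =>
    obtain ⟨z, hz⟩ := ih (fwdDiff 1 f) (by simpa only [Function.iterate_succ_apply] using hx)
    rw [Function.iterate_succ_apply']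
    -- Starting the new fibre at `f 0` makes the summed differences telescope to `f n`.
    refine ⟨(z, f 0), fun n => ?_⟩
    rw [CircleSystem.next_fiber, Finset.sum_congr rfl fun j _ => hz j]
    have := sum_range_fwdDiff f 0 n
    simp only [zero_add] at this
    rw [this, add_sub_cancel]

theorem minimal_iterate_next (S : CircleSystem) (x : S.X) (h : IsForwardMinimal S.next.T) (i : ℕ) :
    IsForwardMinimal (CircleSystem.next^[i + 1] S).T ∧ Nonempty (CircleSystem.next^[i] S).X := by
  induction i with
  | zero => exact ⟨h, ⟨x⟩⟩
  | succ i ih =>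
    obtain ⟨hmin, hne⟩ := ih
    have ⟨z⟩ := hne
    rw [Function.iterate_succ_apply'] at hmin
    rw [Function.iterate_succ_apply', Function.iterate_succ_apply']
    exact ⟨CircleSystem.minimal_next_next _ hmin, ⟨(z, (0 : UnitAddCircle))⟩⟩

/-! ### The induction on the order of differencing -/

theorem syndetic_and_bohr_of_almostPeriodic {f : ℤ → UnitAddCircle} (hf : IsBohrAlmostPeriodic f)
    {ε : ℝ} (hε : 0 < ε) : IsSyndeticInPosInts (posReturnTimes f ε) ∧
      ContainsBohrNhdZero (posReturnTimes f ε - posReturnTimes f ε) := by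
  obtain ⟨φ, hφ, hφf⟩ := hf.exists_continuous
  have hmin : IsForwardMinimal (rotationSystem φ hφ).T := BohrCompactification.isForwardMinimal
  have horb : ∀ n : ℕ, φ ((fun x => x + gen)^[n] 0) = f n := fun n => by
    rw [iterate_add_gen, zero_add, ← hφf, natCast_zsmul]
  refine ⟨isSyndetic_of_minimal (rotationSystem φ hφ) hmin horb hε, ?_⟩
  rw [isBohrAlmostPeriodic_iff] at hf
  refine containsBohrNhdZero_sub_self (hf ε hε) fun m hm => ?_
  refine mem_sub_of_minimal (rotationSystem φ hφ) hmin horb (z := (0 : BohrCompactification)) ?_ ?_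
  · change ‖φ 0 - f 0‖ < ε
    rw [show φ 0 = f 0 by simpa using hφf 0, sub_self, norm_zero]
    exact hε
  · change ‖φ ((fun x => x + gen)^[m] 0) - f 0‖ < ε
    rw [horb]
    simpa using hm 0

theorem syndetic_and_bohr_of_nsmul_not_almostPeriodic {f : ℤ → UnitAddCircle} {k : ℕ}
    (hf : IsBohrAlmostPeriodic ((fwdDiff (1 : ℤ))^[k + 1] f))
    (hnot : ∀ p : ℕ, 0 < p → ¬ IsBohrAlmostPeriodic (p • (fwdDiff (1 : ℤ))^[k] f))
    {ε : ℝ} (hε : 0 < ε) : IsSyndeticInPosInts (posReturnTimes f ε) ∧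
      ContainsBohrNhdZero (posReturnTimes f ε - posReturnTimes f ε) := by
  rw [Function.iterate_succ_apply'] at hf
  obtain ⟨φ, hφ, hφy⟩ := hf.exists_continuous
  set S := rotationSystem φ hφ with hS
  obtain ⟨hmin, -⟩ := minimal_iterate_next S (0 : BohrCompactification)
    (isForwardMinimal_next_rotationSystem hφ hφy hnot) k
  obtain ⟨z, hz⟩ := exists_point_iterate_next S (0 : BohrCompactification) (k + 1) f fun n => by
    rw [Function.iterate_succ_apply', ← hφy]
    change φ ((fun x => x + gen)^[n] 0) = _
    rw [iterate_add_gen, zero_add, natCast_zsmul]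
  refine ⟨isSyndetic_of_minimal _ hmin hz hε, ?_⟩
  suffices hw : ContainsBohrNhdZero {m : ℤ | ∀ n : ℕ, m = n →
      ∃ w : (CircleSystem.next^[k] S).X, ‖∑ j ∈ Finset.range n,
        (CircleSystem.next^[k] S).h ((CircleSystem.next^[k] S).T^[j] w)‖ < ε} by
    refine containsBohrNhdZero_sub_self hw fun m hm => ?_
    obtain ⟨w, hw⟩ := hm m rfl
    rw [Function.iterate_succ_apply'] at hmin
    have hz' : ∃ z : (CircleSystem.next (CircleSystem.next^[k] S)).X, ∀ n : ℕ,
        (CircleSystem.next (CircleSystem.next^[k] S)).h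
          ((CircleSystem.next (CircleSystem.next^[k] S)).T^[n] z) = f n := by
      rw [← Function.iterate_succ_apply' CircleSystem.next]
      exact ⟨z, hz⟩
    obtain ⟨z, hz⟩ := hz'
    -- Above `w`, the fibre point `f 0` returns with error exactly the m-step sum at `w`.
    refine mem_sub_of_minimal _ hmin hz (z := (w, f 0)) ?_ ?_
    · change ‖f 0 - f 0‖ < ε
      rwa [sub_self, norm_zero]
    · rw [CircleSystem.next_fiber, add_sub_cancel_left]
      exact hw
  cases k with
  | zero =>
    refine (hf.exists_return hε).mono ?_
    rintro _ ⟨n, hn⟩ m rfl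
    -- Here n may be negative: any point of the base is allowed.
    refine ⟨(n • gen : BohrCompactification), ?_⟩
    have : ∑ j ∈ Finset.range m, φ ((fun x => x + gen)^[j] (n • gen)) = f (n + m) - f n := by
      rw [← sum_range_fwdDiff]
      refine Finset.sum_congr rfl fun j _ => ?_
      rw [iterate_add_gen, ← natCast_zsmul, ← add_smul, hφy]
      rfl
    change ‖∑ j ∈ Finset.range m, φ ((fun x => x + gen)^[j] (n • gen))‖ < ε
    rw [this]
    exact hn
  | succ k =>
    -- The zero character gives all of ℤ: every m works.
    refine (containsBohrNhdZero_character 0 one_pos).mono fun m _ n _ => ?_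
    obtain ⟨-, ⟨x⟩⟩ := minimal_iterate_next S (0 : BohrCompactification)
      (isForwardMinimal_next_rotationSystem hφ hφy hnot) k
    rw [Function.iterate_succ_apply']
    rcases Nat.eq_zero_or_pos n with rfl | hn
    · exact ⟨(x, (0 : UnitAddCircle)), by simpa using hε⟩
    · obtain ⟨w, hw⟩ := CircleSystem.exists_sum_next_eq_zero _ x hn
      exact ⟨w, by rwa [hw, norm_zero]⟩

theorem syndetic_and_bohr {f : ℤ → UnitAddCircle} {k : ℕ}
    (hf : IsBohrAlmostPeriodic ((fwdDiff (1 : ℤ))^[k] f)) {ε : ℝ} (hε : 0 < ε) :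
    IsSyndeticInPosInts (posReturnTimes f ε) ∧
      ContainsBohrNhdZero (posReturnTimes f ε - posReturnTimes f ε) := by
  induction k with
  | zero => exact syndetic_and_bohr_of_almostPeriodic hf hε
  | succ k ih =>
    by_cases h : ∃ p : ℕ, 0 < p ∧ IsBohrAlmostPeriodic (p • (fwdDiff (1 : ℤ))^[k] f)
    · obtain ⟨p, hp, hap⟩ := h
      rw [Function.iterate_succ_apply'] at hf
      exact ih (hap.of_nsmul hp hf)
    · push Not at h
      exact syndetic_and_bohr_of_nsmul_not_almostPeriodic hf h hε

theorem theoremC (f : ℤ → UnitAddCircle) (k : ℕ)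
    (hf : IsBohrAlmostPeriodic ((fwdDiff (1 : ℤ))^[k] f)) :
    (∀ ε : ℝ, 0 < ε →
      IsSyndeticInPosInts (posReturnTimes f ε) ∧
        ContainsBohrNhdZero (posReturnTimes f ε - posReturnTimes f ε)) ∧
    (∀ ε : ℝ, 0 < ε →
      ContainsBohrNhdZero {m : ℤ | ⨅ n : ℤ, ‖f (n + m) - f n‖ < ε}) := by
  refine ⟨fun ε hε => syndetic_and_bohr hf hε, fun ε hε => ?_⟩
  refine (syndetic_and_bohr hf (half_pos hε)).2.mono fun m hm => ?_
  obtain ⟨a, ⟨-, ha⟩, b, ⟨-, hb⟩, rfl⟩ := Set.mem_sub.1 hm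
  have hbdd : BddBelow (range fun n : ℤ => ‖f (n + (a - b)) - f n‖) :=
    ⟨0, by rintro _ ⟨n, rfl⟩; exact norm_nonneg _⟩
  refine (ciInf_le hbdd b).trans_lt ?_
  have e : f (b + (a - b)) - f b = (f a - f 0) - (f b - f 0) := by
    rw [add_sub_cancel]; abel
  rw [e]
  exact (norm_sub_le _ _).trans_lt (by linarith)
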